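/- Let $A$ and $B$ be groups, $H\le A$ and $K\le B$ subgroups, and $\varphi\colon H\to K$ an isomorphism. Let $G=(A*B;\,H=K,\varphi)$ be the free product of $A$ and $B$ with the subgroups $H$ and $K$ amalgamated by $\varphi$, and regard $A$ and $B$ as subgroups of $G$ in the usual way. A subgroup $F$ of a group $X$ is called finitely separable if for every $g\in X\setminus F$ there is a homomorphism $\psi$ of $X$ onto a finite group with $\psi(g)\notin\psi(F)$. If $\Psi$ is a family of normal subgroups of $X$, then $F$ is called separable by $\Psi$ if $\bigcap_{N\in\Psi}FN=F$; and, for a subgroup $Y\le X$, the family $\Psi$ is called a $Y$-filtration if $\bigcap_{N\in\Psi}N=1$ and $Y$ is separable by $\Psi$. Let $\Omega$ be the family of all pairs $(R,S)$ such that $R$ is a normal subgroup of finite index of $A$, $S$ is a normal subgroup of finite index of $B$, and $\varphi(R\cap H)=S\cap K$. Let $\Omega_A=\{R:(R,S)\in\Omega \text{ for some } S\}$ and $\Omega_B=\{S:(R,S)\in\Omega\text{ for some }R\}$. Let $\Lambda_A$ be the family of all cyclic subgroups of $A$ that are not separable by $\Omega_A$, and $\Lambda_B$ the family of all cyclic subgroups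 of $B$ that are not separable by $\Omega_B$. **Theorem 1.2.** Suppose that $\Omega_A$ is an $H$-filtration and $\Omega_B$ is a $K$-filtration. Then every cyclic subgroup of $G$ that is not conjugate in $G$ to any subgroup belonging to $\Lambda_A\cup\Lambda_B$ is finitely separable in $G$. -/

import Mathlib

open scoped Pointwise

universe u

namespace AmalgSep

section Separability

variable {X : Type u} [Group X]

/-- `F` is finitely separable in `X`: every `g ∉ F` can be separated from `F` by a homomorphism of
`X` onto a finite group. (Such a group is a quotient of `X`, so the universe of `X` suffices.) -/
def FinitelySeparable (F : Subgroup X) : Prop :=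
  ∀ g : X, g ∉ F → ∃ (Q : Type u) (_ : Group Q) (_ : Finite Q) (ψ : X →* Q),
    Function.Surjective ψ ∧ ψ g ∉ F.map ψ

/-- `F` is separable by the subgroups of the family `Ψ`: the intersection of the products `F N`,
`N ∈ Ψ`, is `F`. -/
def SeparableBy (Ψ : Set (Subgroup X)) (F : Subgroup X) : Prop :=
  (⋂ N ∈ Ψ, (F : Set X) * (N : Set X)) = (F : Set X)

/-- The family `Ψ` of normal subgroups is a `Y`-filtration: its intersection is trivial and it
separates `Y`. -/
def IsFiltration (Ψ : Set (Subgroup X)) (Y : Subgroup X) : Prop :=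
  (∀ N ∈ Ψ, N.Normal) ∧ sInf Ψ = ⊥ ∧ SeparableBy Ψ Y

/-- `C` and `D` are conjugate subgroups of `X`. -/
def AreConj (C D : Subgroup X) : Prop :=
  ∃ x : X, C = D.map (MulAut.conj x).toMonoidHom

end Separability

section Amalgam

variable {A B : Type u} [Group A] [Group B]

/-- The two-member family of groups `A`, `B`. -/
def Factor (A B : Type u) : Bool → Type u
  | true => A
  | false => B

instance Factor.group : ∀ i : Bool, Group (Factor A B i)
  | true => inferInstanceAs (Group A)
  | false => inferInstanceAs (Group B)

/-- The embeddings of `H` into `A` (the inclusion) and into `B` (through `φ : H ≃* K`). -/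
def factorMap (H : Subgroup A) (K : Subgroup B) (φ : H ≃* K) : ∀ i : Bool, H →* Factor A B i
  | true => H.subtype
  | false => K.subtype.comp φ.toMonoidHom

/-- The generalized free product `(A * B; H = K, φ)`: the pushout of the embeddings `H → A` and
`H ≃ K → B`. -/
abbrev Amalgam (H : Subgroup A) (K : Subgroup B) (φ : H ≃* K) : Type u :=
  Monoid.PushoutI (factorMap H K φ)

/-- The canonical map of the free factor `A` into the generalized free product. -/
def inA (H : Subgroup A) (K : Subgroup B) (φ : H ≃* K) : A →* Amalgam H K φ :=
  Monoid.PushoutI.of (φ := factorMap H K φ) true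

/-- The canonical map of the free factor `B` into the generalized free product. -/
def inB (H : Subgroup A) (K : Subgroup B) (φ : H ≃* K) : B →* Amalgam H K φ :=
  Monoid.PushoutI.of (φ := factorMap H K φ) false

/-- `R ≤ A` and `S ≤ B` are `(H, K, φ)`-compatible: `φ` maps `R ∩ H` onto `S ∩ K`. -/
def Compatible (H : Subgroup A) (K : Subgroup B) (φ : H ≃* K)
    (R : Subgroup A) (S : Subgroup B) : Prop :=
  (R.subgroupOf H).map φ.toMonoidHom = S.subgroupOf K

/-- The family `Ω` of all `(H, K, φ)`-compatible pairs of normal subgroups of finite index. -/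
def Omega (H : Subgroup A) (K : Subgroup B) (φ : H ≃* K) : Set (Subgroup A × Subgroup B) :=
  {P | P.1.Normal ∧ P.1.FiniteIndex ∧ P.2.Normal ∧ P.2.FiniteIndex ∧ Compatible H K φ P.1 P.2}

/-- The projection `Ω_A` of `Ω` onto `A`. -/
def OmegaA (H : Subgroup A) (K : Subgroup B) (φ : H ≃* K) : Set (Subgroup A) :=
  Prod.fst '' Omega H K φ

/-- The projection `Ω_B` of `Ω` onto `B`. -/
def OmegaB (H : Subgroup A) (K : Subgroup B) (φ : H ≃* K) : Set (Subgroup B) :=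
  Prod.snd '' Omega H K φ

/-- `Λ_A`: the cyclic subgroups of `A` that are not separable by `Ω_A`. -/
def LambdaA (H : Subgroup A) (K : Subgroup B) (φ : H ≃* K) : Set (Subgroup A) :=
  {F | IsCyclic F ∧ ¬ SeparableBy (OmegaA H K φ) F}

/-- `Λ_B`: the cyclic subgroups of `B` that are not separable by `Ω_B`. -/
def LambdaB (H : Subgroup A) (K : Subgroup B) (φ : H ≃* K) : Set (Subgroup B) :=
  {F | IsCyclic F ∧ ¬ SeparableBy (OmegaB H K φ) F}

end Amalgam

end AmalgSep

/-!
The pairs `(R, S)` of `Ω` are families of normal subgroups of finite index of the two factors with a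
common trace on the amalgamated subgroup, so each of them gives a homomorphism `proj` of
`G` to the amalgam of the finite groups `A ⧸ R` and `B ⧸ S`. The proof has two halves.

*Amalgams of finite groups* (`isSeparated_zpowers`). Let `Γ` be an amalgam of finite groups and `C`
a cyclic subgroup without torsion. The factors act freely on `Γ ⧸ C`. For `g ∉ C`, spelling out `g`
and a generator of `C` moves the coset of `1` through finitely many cosets, and the partial action
on these can be completed to an action of `Γ` on a finite set
(`exists_finite_approximation`): complete it to a free action of each factor separately, make all
the resulting sets equally large, and identify them as sets with a free action of the amalgamated
subgroup. In this finite action `C` fixes a point that `g` moves. Applied to the trivial subgroup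
this shows that `Γ` is residually finite, which settles finite cyclic subgroups.

*Reduction to finite factors.* It remains to find, for `g ∉ ⟨c⟩`, a pair in `Ω` such that the image
of `g` is not in the subgroup generated by the image of `c`. The normal form theorem and the
separability of `H` and `K` by `Ω` yield pairs for which finitely many prescribed letters stay
outside the amalgamated subgroup, so reduced words remain reduced.
- If `c` is conjugate to an element `a` of a factor, we may take `c = a`. For `g` in that factor the
  separability of `⟨a⟩` by `Ω` applies, and for other `g` a pair keeping `g` out of the image of the
  factor (`exists_proj_of_notMem_zpowers`).
- Otherwise `c` is conjugate to an element with a cyclically reduced word, which keeps infinite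
  order for a suitable pair. Then at most one power of `c` can have the image of `g`, and a second
  pair excludes this power (`exists_proj_notMem_zpowers`).

The argument does not depend on the number of factors and is carried out for amalgams of finite
families of groups.
-/

namespace AmalgSep

open Monoid PushoutI

/-! ### Reduced words in an amalgam -/

section Words

variable {ι : Type*} {G : ι → Type*} {H : Type*} [∀ i, Group (G i)] [Group H] {φ : ∀ i, H →* G i}

/-- The element of the amalgam spelled by a list of letters from the factors; no reducedness is
required of the list. -/
def wordProd (φ : ∀ i, H →* G i) (l : List (Σ i, G i)) : PushoutI φ :=
  (l.map fun p => of p.1 p.2).prod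

@[simp] theorem wordProd_nil : wordProd φ [] = 1 := rfl

@[simp] theorem wordProd_cons (p : Σ i, G i) (l : List (Σ i, G i)) :
    wordProd φ (p :: l) = of p.1 p.2 * wordProd φ l := by
  simp [wordProd]

theorem wordProd_append (l m : List (Σ i, G i)) :
    wordProd φ (l ++ m) = wordProd φ l * wordProd φ m := by
  simp [wordProd]

theorem wordProd_flatten_replicate (l : List (Σ i, G i)) (n : ℕ) :
    wordProd φ (List.replicate n l).flatten = wordProd φ l ^ n := by
  induction n with
  | zero => simp
  | succ n ih => simp [List.replicate_succ, wordProd_append, ih, pow_succ']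

theorem exists_wordProd_eq [Nonempty ι] (x : PushoutI φ) : ∃ l, wordProd φ l = x := by
  induction x using PushoutI.induction_on with
  | of i g => exact ⟨[⟨i, g⟩], by simp⟩
  | base h =>
    obtain ⟨i⟩ := ‹Nonempty ι›
    exact ⟨[⟨i, φ i h⟩], by simp [of_apply_eq_base]⟩
  | mul x y hx hy =>
    obtain ⟨l, rfl⟩ := hx
    obtain ⟨m, rfl⟩ := hy
    exact ⟨l ++ m, wordProd_append l m⟩

/-- A list of letters is reduced if neighbouring letters come from different factors and no letter
lies in the amalgamated subgroup. -/
structure IsReduced (φ : ∀ i, H →* G i) (l : List (Σ i, G i)) : Prop where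
  chain : l.IsChain fun p q => p.1 ≠ q.1
  notMem : ∀ p ∈ l, p.2 ∉ (φ p.1).range

theorem IsReduced.exists_word {l : List (Σ i, G i)} (hl : IsReduced φ l) :
    ∃ w : CoprodI.Word G, w.toList = l ∧ Reduced φ w ∧ ofCoprodI w.prod = wordProd φ l := by
  refine ⟨⟨l, ?_, hl.chain⟩, rfl, hl.notMem, ?_⟩
  · intro p hp h
    exact hl.notMem p hp (h ▸ one_mem _)
  · simp [CoprodI.Word.prod, wordProd, map_list_prod, Function.comp_def]

theorem IsReduced.map_fst_eq (hφ : ∀ i, Function.Injective (φ i)) {l m : List (Σ i, G i)}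
    (hl : IsReduced φ l) (hm : IsReduced φ m) (h : wordProd φ l = wordProd φ m) :
    l.map Sigma.fst = m.map Sigma.fst := by
  obtain ⟨v, rfl, hv, hvl⟩ := hl.exists_word
  obtain ⟨w, rfl, hw, hwm⟩ := hm.exists_word
  obtain ⟨d⟩ := NormalWord.transversal_nonempty φ hφ
  obtain ⟨v', hv', hv''⟩ := hv.exists_normalWord_prod_eq d
  obtain ⟨w', hw', hw''⟩ := hw.exists_normalWord_prod_eq d
  have : v' = w' := NormalWord.prod_injective (by rw [hv', hw', hvl, hwm, h])
  rw [← hv'', ← hw'', this]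

theorem IsReduced.wordProd_notMem_range_base (hφ : ∀ i, Function.Injective (φ i))
    {l : List (Σ i, G i)} (hl : IsReduced φ l) (hne : l ≠ []) :
    wordProd φ l ∉ (base φ).range := by
  obtain ⟨w, rfl, hw, hwl⟩ := hl.exists_word
  intro h
  rw [← hwl] at h
  exact hne (by rw [hw.eq_empty_of_mem_range hφ h]; rfl)

theorem IsReduced.wordProd_notMem_range_of (hφ : ∀ i, Function.Injective (φ i))
    {l : List (Σ i, G i)} (hl : IsReduced φ l) (hne : l ≠ []) {i : ι}
    (hi : l.map Sigma.fst ≠ [i]) : wordProd φ l ∉ (of (φ := φ) i).range := by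
  rintro ⟨a, ha⟩
  by_cases har : a ∈ (φ i).range
  · obtain ⟨h, rfl⟩ := har
    exact hl.wordProd_notMem_range_base hφ hne ⟨h, by rw [← ha, of_apply_eq_base]⟩
  · have : IsReduced φ [⟨i, a⟩] := ⟨by simp, by simpa using har⟩
    exact hi (hl.map_fst_eq hφ this (by simp [ha]))

theorem IsReduced.flatten_replicate {l : List (Σ i, G i)} (hl : IsReduced φ (l ++ l)) (n : ℕ) :
    IsReduced φ (List.replicate n l).flatten := by
  refine ⟨?_, fun p hp => hl.notMem p ?_⟩
  · have h := List.isChain_append.1 hl.chain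
    induction n with
    | zero => simp
    | succ n ih =>
      rw [List.replicate_succ, List.flatten_cons]
      refine List.isChain_append.2 ⟨h.1, ih, fun x hx y hy => ?_⟩
      cases n with
      | zero => simp at hy
      | succ n =>
        refine h.2.2 x hx y ?_
        rw [List.replicate_succ, List.flatten_cons, List.head?_append] at hy
        cases l with
        | nil => simp at hx
        | cons a l => simpa using hy
  · simp only [List.mem_flatten, List.mem_replicate] at hp
    obtain ⟨_, ⟨_, rfl⟩, hp⟩ := hp
    simp [hp]

/-- A cyclically reduced word (one whose square is reduced) spells an element of infinite order. -/
theorem IsReduced.orderOf_eq_zero (hφ : ∀ i, Function.Injective (φ i)) {l : List (Σ i, G i)}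
    (hl : IsReduced φ (l ++ l)) (hne : l ≠ []) : orderOf (wordProd φ l) = 0 := by
  rw [orderOf_eq_zero_iff']
  intro n hn h
  refine (hl.flatten_replicate n).wordProd_notMem_range_base hφ ?_
    (by rw [wordProd_flatten_replicate, h]; exact one_mem _)
  obtain ⟨n, rfl⟩ := Nat.exists_eq_succ_of_ne_zero hn.ne'
  simp [List.replicate_succ, hne]

/-- Two neighbouring letters merge into one if they come from the same factor or if one of them
lies in the amalgamated subgroup. -/
theorem exists_of_mul_of_eq {p q : Σ i, G i}
    (h : p.1 = q.1 ∨ p.2 ∈ (φ p.1).range ∨ q.2 ∈ (φ q.1).range) :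
    ∃ r : Σ i, G i, of (φ := φ) p.1 p.2 * of q.1 q.2 = of r.1 r.2 := by
  obtain ⟨i, a⟩ := p
  obtain ⟨j, b⟩ := q
  rcases h with h | ⟨x, h⟩ | ⟨x, h⟩
  · dsimp at h
    subst h
    exact ⟨⟨i, a * b⟩, by simp⟩
  · obtain rfl : φ i x = a := h
    exact ⟨⟨j, φ j x * b⟩, by simp [of_apply_eq_base]⟩
  · obtain rfl : φ j x = b := h
    exact ⟨⟨i, a * φ i x⟩, by simp [of_apply_eq_base]⟩

/-- A list of at least two letters no two neighbours of which merge is reduced. -/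
theorem isReduced_of_forall_infix {l : List (Σ i, G i)} (hlen : 2 ≤ l.length)
    (h : ∀ s p q t, l = s ++ p :: q :: t →
      ¬ (p.1 = q.1 ∨ p.2 ∈ (φ p.1).range ∨ q.2 ∈ (φ q.1).range)) :
    IsReduced φ l := by
  constructor
  · rw [List.isChain_iff_forall_rel_of_append_cons_cons]
    intro p q s t hst
    exact fun hpq => h s p q t hst (Or.inl hpq)
  · intro p hp hmem
    obtain ⟨s, t, rfl⟩ := List.append_of_mem hp
    cases t with
    | cons q t => exact h s p q t rfl (Or.inr (Or.inl hmem))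
    | nil =>
      rcases List.eq_nil_or_concat s with rfl | ⟨s, q, rfl⟩
      · simp at hlen
      · exact h s q p [] (by simp) (Or.inr (Or.inr hmem))

theorem eq_of_of_length_lt_two [Nonempty ι] {l : List (Σ i, G i)} (h : l.length < 2) :
    ∃ i a, wordProd φ l = of i a := by
  match l, h with
  | [], _ => exact ⟨Classical.arbitrary ι, 1, by simp⟩
  | [p], _ => exact ⟨p.1, p.2, by simp⟩

/-- Every element of the amalgam lies in a factor or is spelled by a reduced word with at least two
letters, namely by a word of minimal length. -/
theorem eq_of_or_exists_isReduced [Nonempty ι] (x : PushoutI φ) :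
    (∃ i a, x = of i a) ∨ ∃ l, IsReduced φ l ∧ 2 ≤ l.length ∧ wordProd φ l = x := by
  obtain ⟨l, hl, hmin⟩ := exists_minimalFor_of_wellFoundedLT
    (fun l => wordProd φ l = x) List.length (exists_wordProd_eq x)
  rcases lt_or_ge l.length 2 with h | h
  · obtain ⟨i, a, hia⟩ := eq_of_of_length_lt_two (φ := φ) h
    exact Or.inl ⟨i, a, hl ▸ hia⟩
  · refine Or.inr ⟨l, isReduced_of_forall_infix h ?_, h, hl⟩
    rintro s p q t rfl hpq
    obtain ⟨r, hr⟩ := exists_of_mul_of_eq hpq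
    have := hmin (j := s ++ r :: t) (by
      rw [← hl]
      simp [wordProd_append, ← hr, mul_assoc]) (by simp)
    simp at this

/-- Every element of the amalgam is conjugate to an element of a factor or to one spelled by a
cyclically reduced word, namely by a shortest word spelling a conjugate. -/
theorem exists_conj_of_or_exists_isReduced [Nonempty ι] (x : PushoutI φ) :
    (∃ y i a, x = y * of i a * y⁻¹) ∨
      ∃ y l, IsReduced φ (l ++ l) ∧ l ≠ [] ∧ x = y * wordProd φ l * y⁻¹ := by
  obtain ⟨l, ⟨y, hl⟩, hmin⟩ := exists_minimalFor_of_wellFoundedLT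
    (fun l => ∃ y, x = y * wordProd φ l * y⁻¹) List.length
    ((exists_wordProd_eq x).imp fun l hl => ⟨1, by simp [hl]⟩)
  rcases lt_or_ge l.length 2 with h | h
  · obtain ⟨i, a, hia⟩ := eq_of_of_length_lt_two (φ := φ) h
    exact Or.inl ⟨y, i, a, hia ▸ hl⟩
  · have hred : IsReduced φ l := by
      refine isReduced_of_forall_infix h ?_
      rintro s p q t rfl hpq
      obtain ⟨r, hr⟩ := exists_of_mul_of_eq hpq
      have := hmin (j := s ++ r :: t) ⟨y, by
        rw [hl]
        simp [wordProd_append, ← hr, mul_assoc]⟩ (by simp)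
      simp at this
    refine Or.inr ⟨y, l, ⟨?_, ?_⟩, ?_, hl⟩
    · refine List.isChain_append.2 ⟨hred.chain, hred.chain, ?_⟩
      -- If the last and the first letter came from the same factor, a cyclic shift of the word
      -- would bring them together, and they would merge.
      intro p hp q hq hpq
      obtain ⟨s, rfl⟩ : ∃ s, l = q :: s := by
        cases l with
        | nil => simp at hq
        | cons a s => simp at hq; exact ⟨s, by rw [hq]⟩
      obtain rfl | ⟨s, p', rfl⟩ := List.eq_nil_or_concat s
      · simp at h
      obtain rfl : p' = p := by
        have hp' : (q :: s ++ [p']).getLast? = some p := by simpa using hp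
        rw [List.getLast?_concat] at hp'
        exact Option.some.inj hp'
      obtain ⟨r, hr⟩ := exists_of_mul_of_eq (φ := φ) (Or.inl hpq)
      have := hmin (j := r :: s) ⟨y * (of p'.1 p'.2)⁻¹, by
        rw [hl]
        simp [wordProd_append, ← hr, mul_assoc]⟩ (by simp)
      simp at this
    · intro p hp
      exact hred.notMem p (by simpa using hp)
    · rintro rfl
      simp at h

end Words

/-! ### Amalgams of finite quotients -/

section CompatibleFamilies

variable {ι : Type*} {G : ι → Type*} {H : Type*} [∀ i, Group (G i)] [Group H]

/-- A family of normal subgroups `N i ≤ G i` of finite index whose preimages in the amalgamated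
subgroup `H` are all equal; the field `M` records this common preimage. -/
structure CompatibleFamily (φ : ∀ i, H →* G i) where
  N : ∀ i, Subgroup (G i)
  M : Subgroup H
  normal : ∀ i, (N i).Normal
  finiteIndex : ∀ i, (N i).FiniteIndex
  normal_base : M.Normal
  comap_eq : ∀ i, (N i).comap (φ i) = M

namespace CompatibleFamily

variable {φ : ∀ i, H →* G i} (D : CompatibleFamily φ)

instance (i : ι) : (D.N i).Normal := D.normal i

instance (i : ι) : (D.N i).FiniteIndex := D.finiteIndex i

instance : D.M.Normal := D.normal_base

/-- The embeddings `H ⧸ M →* G i ⧸ N i` induced by `φ i`. -/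
def quotMap (i : ι) : H ⧸ D.M →* G i ⧸ D.N i :=
  QuotientGroup.map D.M (D.N i) (φ i) (D.comap_eq i).ge

theorem quotMap_injective (i : ι) : Function.Injective (D.quotMap i) := by
  rw [injective_iff_map_eq_one]
  intro x hx
  induction x using QuotientGroup.induction_on with
  | H x =>
    rw [quotMap, QuotientGroup.map_mk, QuotientGroup.eq_one_iff] at hx
    rw [QuotientGroup.eq_one_iff, ← D.comap_eq i]
    exact hx

/-- The amalgam of the finite quotients `G i ⧸ N i`. -/
abbrev QuotAmalgam : Type _ := PushoutI D.quotMap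

/-- The homomorphism from the amalgam of the `G i` to the amalgam of the `G i ⧸ N i`. -/
def proj : PushoutI φ →* D.QuotAmalgam :=
  lift (fun i => (of i).comp (QuotientGroup.mk' (D.N i)))
    ((base D.quotMap).comp (QuotientGroup.mk' D.M)) fun i => by
      ext h
      exact of_apply_eq_base D.quotMap i (h : H ⧸ D.M)

@[simp] theorem proj_of {i : ι} (a : G i) :
    D.proj (of i a) = of (φ := D.quotMap) i (a : G i ⧸ D.N i) := by
  simp [proj]

theorem mk_mem_range_quotMap {i : ι} (a : G i) :
    (a : G i ⧸ D.N i) ∈ (D.quotMap i).range ↔ ∃ h, (φ i h)⁻¹ * a ∈ D.N i := by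
  constructor
  · rintro ⟨x, hx⟩
    induction x using QuotientGroup.induction_on with
    | H x => exact ⟨x, QuotientGroup.eq.1 hx⟩
  · rintro ⟨h, hh⟩
    exact ⟨(h : H ⧸ D.M), QuotientGroup.eq.2 hh⟩

/-- The letters of a word, reduced modulo the `N i`. -/
def mapWord (l : List (Σ i, G i)) : List (Σ i, G i ⧸ D.N i) :=
  l.map fun p => ⟨p.1, p.2⟩

theorem wordProd_mapWord (l : List (Σ i, G i)) :
    wordProd D.quotMap (D.mapWord l) = D.proj (wordProd φ l) := by
  simp [wordProd, mapWord, map_list_prod, Function.comp_def]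

theorem map_fst_mapWord (l : List (Σ i, G i)) :
    (D.mapWord l).map Sigma.fst = l.map Sigma.fst := by
  simp [mapWord, Function.comp_def]

theorem isReduced_mapWord {l : List (Σ i, G i)} (hl : IsReduced φ l)
    (h : ∀ p ∈ l, ∀ x, (φ p.1 x)⁻¹ * p.2 ∉ D.N p.1) : IsReduced D.quotMap (D.mapWord l) := by
  constructor
  · rw [mapWord, List.isChain_map]
    exact hl.chain
  · intro p hp
    simp only [mapWord, List.mem_map] at hp
    obtain ⟨q, hq, rfl⟩ := hp
    rw [D.mk_mem_range_quotMap]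
    exact fun ⟨x, hx⟩ => h q hq x hx

/-- Compatible families are ordered by inclusion, so smaller families have larger quotients. -/
instance : LE (CompatibleFamily φ) := ⟨fun D E => ∀ i, D.N i ≤ E.N i⟩

instance : Min (CompatibleFamily φ) :=
  ⟨fun D E =>
    { N := fun i => D.N i ⊓ E.N i
      M := D.M ⊓ E.M
      normal := fun _ => inferInstance
      finiteIndex := fun _ => inferInstance
      normal_base := inferInstance
      comap_eq := fun i => by rw [Subgroup.comap_inf, D.comap_eq, E.comap_eq] }⟩

instance : Top (CompatibleFamily φ) :=
  ⟨{ N := fun _ => ⊤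
     M := ⊤
     normal := fun _ => inferInstance
     finiteIndex := fun _ => inferInstance
     normal_base := inferInstance
     comap_eq := fun _ => Subgroup.comap_top _ }⟩

theorem inf_le_left (D E : CompatibleFamily φ) : D ⊓ E ≤ D := fun _ _ h => h.1

theorem inf_le_right (D E : CompatibleFamily φ) : D ⊓ E ≤ E := fun _ _ h => h.2

theorem ker_proj_mono [Nonempty ι] {D E : CompatibleFamily φ} (h : D ≤ E) :
    D.proj.ker ≤ E.proj.ker := by
  have hM : D.M ≤ E.M := by
    let i := Classical.arbitrary ι
    rw [← D.comap_eq i, ← E.comap_eq i]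
    exact Subgroup.comap_mono (h i)
  -- `E.proj` factors through `D.proj`.
  let f : D.QuotAmalgam →* E.QuotAmalgam :=
    lift (fun i => (of i).comp (QuotientGroup.map (D.N i) (E.N i) (MonoidHom.id _) (h i)))
      ((base E.quotMap).comp (QuotientGroup.map D.M E.M (MonoidHom.id _) hM)) fun i => by
        ext x
        exact of_apply_eq_base E.quotMap i (x : H ⧸ E.M)
  have hf : f.comp D.proj = E.proj := by
    refine hom_ext_nonempty fun i => ?_
    ext a
    simp only [f, MonoidHom.comp_apply, proj_of, lift_of]
    rfl
  intro x hx
  rw [MonoidHom.mem_ker] at hx ⊢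
  rw [← hf, MonoidHom.comp_apply, hx, map_one]

/-- The compatible families separate the points of the factors and separate the amalgamated
subgroup in each factor. -/
structure Separating (φ : ∀ i, H →* G i) : Prop where
  exists_notMem : ∀ i (a : G i), a ≠ 1 → ∃ D : CompatibleFamily φ, a ∉ D.N i
  exists_range : ∀ i (a : G i), a ∉ (φ i).range →
    ∃ D : CompatibleFamily φ, ∀ x, (φ i x)⁻¹ * a ∉ D.N i

/-- Some compatible family keeps all letters of a given word outside the amalgamated subgroup. -/
theorem Separating.exists_word (hs : Separating φ) (l : List (Σ i, G i))
    (hl : ∀ p ∈ l, p.2 ∉ (φ p.1).range) :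
    ∃ D : CompatibleFamily φ, ∀ p ∈ l, ∀ x, (φ p.1 x)⁻¹ * p.2 ∉ D.N p.1 := by
  induction l with
  | nil => exact ⟨⊤, by simp⟩
  | cons p l ih =>
    obtain ⟨D, hD⟩ := ih fun q hq => hl q (List.mem_cons_of_mem _ hq)
    obtain ⟨E, hE⟩ := hs.exists_range p.1 p.2 (hl p List.mem_cons_self)
    refine ⟨D ⊓ E, fun q hq x hx => ?_⟩
    rcases List.mem_cons.1 hq with rfl | hq
    · exact hE x (inf_le_right D E _ hx)
    · exact hD q hq x (inf_le_left D E _ hx)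

/-- An element outside the factor `G i` has a reduced word other than a single letter of `G i`, and
it stays outside as long as this word stays reduced. -/
theorem Separating.exists_proj_notMem_range [Nonempty ι] (hs : Separating φ) {i : ι}
    {x : PushoutI φ} (hx : x ∉ (of (φ := φ) i).range) :
    ∃ D : CompatibleFamily φ, D.proj x ∉ (of (φ := D.quotMap) i).range := by
  obtain ⟨l, hl, hne, hi, rfl⟩ :
      ∃ l, IsReduced φ l ∧ l ≠ [] ∧ l.map Sigma.fst ≠ [i] ∧ wordProd φ l = x := by
    obtain ⟨j, a, rfl⟩ | ⟨l, hl, hlen, rfl⟩ := eq_of_or_exists_isReduced x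
    · refine ⟨[⟨j, a⟩], ⟨by simp, ?_⟩, by simp, ?_, by simp⟩
      · rintro p hp ⟨h, hh⟩
        obtain rfl := List.mem_singleton.1 hp
        obtain rfl : φ j h = a := hh
        exact hx ⟨φ i h, by rw [of_apply_eq_base, of_apply_eq_base]⟩
      · rintro h
        obtain rfl : j = i := by simpa using h
        exact hx ⟨a, rfl⟩
    · refine ⟨l, hl, ?_, ?_, rfl⟩
      · rintro rfl
        simp at hlen
      · intro h
        have := congrArg List.length h
        simp at this
        omega
  obtain ⟨D, hD⟩ := hs.exists_word l hl.notMem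
  refine ⟨D, ?_⟩
  rw [← D.wordProd_mapWord]
  refine (D.isReduced_mapWord hl hD).wordProd_notMem_range_of D.quotMap_injective ?_ ?_
  · simpa [mapWord] using hne
  · rwa [D.map_fst_mapWord]

theorem Separating.exists_proj_ne_one [Nonempty ι] (hs : Separating φ) {x : PushoutI φ}
    (hx : x ≠ 1) : ∃ D : CompatibleFamily φ, D.proj x ≠ 1 := by
  let i := Classical.arbitrary ι
  by_cases hxi : x ∈ (of (φ := φ) i).range
  · obtain ⟨a, rfl⟩ := hxi
    obtain ⟨D, hD⟩ := hs.exists_notMem i a (by rintro rfl; simp at hx)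
    refine ⟨D, fun h => hD ?_⟩
    rw [D.proj_of] at h
    rw [← QuotientGroup.eq_one_iff]
    exact of_injective D.quotMap_injective i (by rw [h, map_one])
  · obtain ⟨D, hD⟩ := hs.exists_proj_notMem_range hxi
    exact ⟨D, fun h => hD (h ▸ one_mem _)⟩

/-- An element that is not conjugate into a factor keeps infinite order in the amalgam of some
finite quotients: it suffices to keep the letters of a cyclically reduced conjugate outside the
amalgamated subgroup. -/
theorem Separating.exists_orderOf_proj_eq_zero [Nonempty ι] (hs : Separating φ) {c : PushoutI φ}
    (hc : ∀ y i a, c ≠ y * of i a * y⁻¹) :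
    ∃ D : CompatibleFamily φ, orderOf (D.proj c) = 0 := by
  obtain ⟨y, i, a, h⟩ | ⟨y, l, hl, hne, rfl⟩ := exists_conj_of_or_exists_isReduced c
  · exact absurd h (hc y i a)
  · obtain ⟨D, hD⟩ := hs.exists_word (l ++ l) hl.notMem
    have := D.isReduced_mapWord hl hD
    rw [mapWord, List.map_append] at this
    refine ⟨D, ?_⟩
    rw [map_mul, map_mul, map_inv, ← MulAut.conj_apply, MulEquiv.orderOf_eq, ← D.wordProd_mapWord]
    exact IsReduced.orderOf_eq_zero D.quotMap_injective this (by simpa [mapWord] using hne)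

end CompatibleFamily

end CompatibleFamilies

/-! ### Finite actions of amalgams of finite groups -/

section FiniteAmalgams

/-- A set with a free action of `U` is parametrized by `u • b q`, for any section `b` of the map to
the orbits. -/
theorem bijective_smul_section {U S : Type*} [Group U] [MulAction U S]
    (hfree : ∀ (u : U) (s : S), u • s = s → u = 1) (b : MulAction.orbitRel.Quotient U S → S)
    (hb : ∀ q, (⟦b q⟧ : MulAction.orbitRel.Quotient U S) = q) :
    Function.Bijective fun p : U × MulAction.orbitRel.Quotient U S => p.1 • b p.2 := by
  constructor
  · rintro ⟨u, q⟩ ⟨v, r⟩ h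
    dsimp at h
    have hqr : q = r := by
      rw [← hb q, ← hb r]
      refine Quotient.sound ⟨u⁻¹ * v, ?_⟩
      dsimp
      rw [mul_smul, ← h, inv_smul_smul]
    subst hqr
    have := hfree (v⁻¹ * u) (b q) (by rw [mul_smul, h, inv_smul_smul])
    rw [inv_mul_eq_one] at this
    rw [this]
  · intro s
    have : (⟦b ⟦s⟧⟧ : MulAction.orbitRel.Quotient U S) = ⟦s⟧ := hb _
    obtain ⟨u, hu⟩ := Quotient.exact this.symm
    exact ⟨(u, ⟦s⟧), hu⟩

/-- Extension of equivariant partial bijections between free sets. Two finite free `U`-sets of the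
same size, each containing a copy of the `U`-invariant set `Y`, are isomorphic by an isomorphism
that matches the two copies. -/
theorem exists_equivariant_equiv {U Z S T : Type*} [Group U] [Finite U] [Nonempty Z] [MulAction U Z]
    [MulAction U S] [MulAction U T] [Finite S] [Finite T]
    (hS : ∀ (u : U) (s : S), u • s = s → u = 1) (hT : ∀ (u : U) (t : T), u • t = t → u = 1)
    (hcard : Nat.card S = Nat.card T) {Y : Set Z} (hY : ∀ (u : U), ∀ y ∈ Y, u • y ∈ Y)
    (j : Z → S) (hj : ∀ (u : U) z, j (u • z) = u • j z) (hjY : Y.InjOn j)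
    (k : Z → T) (hk : ∀ (u : U) z, k (u • z) = u • k z) (hkY : Y.InjOn k) :
    ∃ e : S ≃ T, (∀ (u : U) s, e (u • s) = u • e s) ∧ ∀ y ∈ Y, e (j y) = k y := by
  classical
  let QS := MulAction.orbitRel.Quotient U S
  let QT := MulAction.orbitRel.Quotient U T
  have hQ : Nat.card QS = Nat.card QT := by
    have h1 := Nat.card_congr (Equiv.ofBijective _
      (bijective_smul_section hS Quotient.out fun q => Quotient.out_eq q))
    have h2 := Nat.card_congr (Equiv.ofBijective _
      (bijective_smul_section hT Quotient.out fun q => Quotient.out_eq q))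
    rw [Nat.card_prod] at h1 h2
    exact Nat.eq_of_mul_eq_mul_left Nat.card_pos (h1.trans (hcard.trans h2.symm))
  -- The orbits that meet the copy of `Y`, with a point `y q` of `Y` chosen in each.
  let I : Set QS := {q | ∃ y ∈ Y, (⟦j y⟧ : QS) = q}
  choose! y hyY hy using fun (q : QS) (hq : q ∈ I) => hq
  have hmk : ∀ a ∈ Y, ∀ b ∈ Y, (⟦k a⟧ : QT) = ⟦k b⟧ → (⟦j a⟧ : QS) = ⟦j b⟧ := by
    intro a ha b hb h
    obtain ⟨u, hu⟩ := Quotient.exact h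
    refine Quotient.sound ⟨u, ?_⟩
    dsimp at hu ⊢
    rw [← hk] at hu
    rw [← hj, hkY (hY u b hb) ha hu]
  have hinj : I.InjOn fun q => (⟦k (y q)⟧ : QT) := by
    intro q hq r hr h
    rw [← hy q hq, ← hy r hr]
    exact hmk _ (hyY q hq) _ (hyY r hr) h
  obtain ⟨F, hF⟩ : ∃ F : QS ≃ QT, ∀ q ∈ I, F q = ⟦k (y q)⟧ := by
    have := Fintype.ofFinite QS
    have := Fintype.ofFinite QT
    obtain ⟨g, hg⟩ := Set.MapsTo.exists_equiv_extend_of_card_eq (t := (Finset.univ : Finset QT))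
      (by simpa [Nat.card_eq_fintype_card] using hQ) (s := I)
      (f := fun q => (⟦k (y q)⟧ : QT)) (fun _ _ => by simp) hinj
    exact ⟨g.trans (Equiv.subtypeUnivEquiv (by simp)), hg⟩
  let b : QS → S := fun q => if q ∈ I then j (y q) else q.out
  have hb : ∀ q, (⟦b q⟧ : QS) = q := by
    intro q
    by_cases hq : q ∈ I
    · simp only [b, if_pos hq, hy q hq]
    · simp only [b, if_neg hq]
      exact Quotient.out_eq q
  let b' : QT → T := fun r => if F.symm r ∈ I then k (y (F.symm r)) else r.out
  have hb' : ∀ r, (⟦b' r⟧ : QT) = r := by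
    intro r
    by_cases hr : F.symm r ∈ I
    · simp only [b', if_pos hr, ← hF _ hr, F.apply_symm_apply]
    · simp only [b', if_neg hr]
      exact Quotient.out_eq r
  let eS := Equiv.ofBijective _ (bijective_smul_section hS b hb)
  let eT := Equiv.ofBijective _ (bijective_smul_section hT b' hb')
  let e : S ≃ T := eS.symm.trans ((Equiv.prodCongr (Equiv.refl U) F).trans eT)
  have he : ∀ (u : U) q, e (u • b q) = u • b' (F q) := by
    intro u q
    have : eS.symm (u • b q) = (u, q) := eS.symm_apply_eq.2 rfl
    simp only [e, Equiv.trans_apply, this]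
    rfl
  refine ⟨e, fun u s => ?_, fun z hz => ?_⟩
  · obtain ⟨⟨v, q⟩, rfl⟩ := eS.surjective s
    change e (u • v • b q) = u • e (v • b q)
    rw [smul_smul, he, he, smul_smul]
  · have hq : (⟦j z⟧ : QS) ∈ I := ⟨z, hz, rfl⟩
    obtain ⟨u, hu⟩ := Quotient.exact (hy _ hq).symm
    dsimp at hu
    have hz' : u • y ⟦j z⟧ = z := hjY (hY u _ (hyY _ hq)) hz (by rw [hj, hu])
    have h1 : b ⟦j z⟧ = j (y ⟦j z⟧) := if_pos hq
    have h2 : b' (F ⟦j z⟧) = k (y ⟦j z⟧) := by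
      simp only [b', F.symm_apply_apply, if_pos hq]
    rw [← hu, ← h1, he, h2, ← hk, hz']

/-- A free `G`-set maps equivariantly to `G × Fin n`, injectively on any given subset with at most
`n` elements. -/
theorem exists_equivariant_injOn {G Z : Type*} [Group G] [MulAction G Z]
    (hfree : ∀ (g : G) (z : Z), g • z = z → g = 1) {Y : Set Z} (hY : Y.Finite) {n : ℕ}
    (hn : 0 < n) (hYn : Y.ncard ≤ n) :
    ∃ j : Z → G × Fin n, (∀ (g : G) z, j (g • z) = (g * (j z).1, (j z).2)) ∧ Y.InjOn j := by
  let Q := MulAction.orbitRel.Quotient G Z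
  let e := Equiv.ofBijective _
    (bijective_smul_section (U := G) (S := Z) hfree Quotient.out fun q => Quotient.out_eq q)
  have : Nonempty (Fin n) := ⟨⟨0, hn⟩⟩
  let I : Set Q := (fun z => (⟦z⟧ : Q)) '' Y
  obtain ⟨t, -, ht⟩ : ∃ t : Q → Fin n, I ⊆ t ⁻¹' Set.univ ∧ I.InjOn t := by
    refine Set.Finite.exists_injOn_of_encard_le (hY.image _) ?_
    rw [Set.encard_univ, ENat.card_eq_coe_fintype_card, Fintype.card_fin]
    refine (Set.encard_image_le _ _).trans ?_
    rw [← hY.cast_ncard_eq]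
    exact_mod_cast hYn
  have he : ∀ (g : G) z, e.symm (g • z) = (g * (e.symm z).1, (e.symm z).2) := by
    intro g z
    rw [e.symm_apply_eq]
    change _ = (g * (e.symm z).1) • (e.symm z).2.out
    rw [mul_smul]
    exact congrArg (g • ·) (e.apply_symm_apply z).symm
  have hsnd : ∀ z, (e.symm z).2 = ⟦z⟧ := by
    intro z
    have h : (e.symm z).1 • (e.symm z).2.out = z := e.apply_symm_apply z
    conv_rhs => rw [← h]
    conv_lhs => rw [← Quotient.out_eq (e.symm z).2]
    exact Quotient.sound ⟨(e.symm z).1⁻¹, by simp⟩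
  refine ⟨fun z => ((e.symm z).1, t (e.symm z).2), fun g z => by simp only [he], ?_⟩
  intro y hy z hz h
  rw [Prod.mk.injEq] at h
  have h2 : (e.symm y).2 = (e.symm z).2 :=
    ht ⟨y, hy, (hsnd y).symm⟩ ⟨z, hz, (hsnd z).symm⟩ h.2
  exact e.symm.injective (Prod.ext h.1 h2)

variable {ι : Type*} {G : ι → Type*} {H : Type*} [∀ i, Group (G i)] [Group H] {φ : ∀ i, H →* G i}

/-- Finite approximation of actions of an amalgam of finite groups. If the factors act freely on
`Z`, then for any finite part `Y` of `Z` there is an action on a finite set `X` that agrees with the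
action on `Z` along every step from a point of `Y` to a point of `Y`. The set `X` is assembled from
free orbits: the partial actions of the factors `G i` on `Y` are completed to free actions on sets
`G i × Fin (n i)` of one common size, which are then identified with each other as `H`-sets. -/
theorem exists_finite_approximation [Finite ι] [Nonempty ι] [∀ i, Finite (G i)] [Finite H]
    (hφ : ∀ i, Function.Injective (φ i)) {Z : Type*} [Nonempty Z]
    [MulAction (PushoutI φ) Z]
    (hfree : ∀ i (a : G i) (z : Z), of (φ := φ) i a • z = z → a = 1)
    {Y : Set Z} (hY : Y.Finite) :
    ∃ (n : ℕ) (ψ : PushoutI φ →* Equiv.Perm (H × Fin n)) (j : Z → H × Fin n), Y.InjOn j ∧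
      ∀ i (a : G i), ∀ y ∈ Y, of (φ := φ) i a • y ∈ Y →
        ψ (of i a) (j y) = j (of (φ := φ) i a • y) := by
  have := Fintype.ofFinite ι
  let : MulAction H Z := MulAction.compHom Z (base φ)
  have hbase : ∀ i (h : H) (z : Z), h • z = of (φ := φ) i (φ i h) • z := by
    intro i h z
    rw [of_apply_eq_base]
    rfl
  have hfreeH : ∀ (h : H) (z : Z), h • z = z → h = 1 := by
    intro h z hz
    let i := Classical.arbitrary ι
    rw [hbase i] at hz
    exact (injective_iff_map_eq_one _).1 (hφ i) h (hfree i _ z hz)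
  -- Enlarge `Y` to an `H`-invariant finite set.
  let Y' : Set Z := Set.image2 (fun (h : H) y => h • y) Set.univ Y
  have hY' : Y'.Finite := Set.finite_univ.image2 _ hY
  have hsub : Y ⊆ Y' := fun y hy => ⟨1, trivial, y, hy, one_smul _ _⟩
  have hinv : ∀ (h : H), ∀ y ∈ Y', h • y ∈ Y' := by
    rintro h _ ⟨k, -, y, hy, rfl⟩
    exact ⟨h * k, trivial, y, hy, mul_smul _ _ _⟩
  -- The common size of all the sets is `N`.
  let N : ℕ := (Y'.ncard + 1) * (Nat.card H * ∏ i, Nat.card (G i))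
  have hcard : ∀ m, m ∣ Nat.card H * ∏ i, Nat.card (G i) →
      ∃ n, 0 < n ∧ Y'.ncard ≤ n ∧ m * n = N := by
    rintro m ⟨r, hr⟩
    have hpos : 0 < m * r := by
      rw [← hr]
      exact Nat.mul_pos Nat.card_pos (Finset.prod_pos fun i _ => Nat.card_pos)
    have hr0 : 0 < r := Nat.pos_of_mul_pos_left hpos
    refine ⟨(Y'.ncard + 1) * r, by positivity, by nlinarith, ?_⟩
    simp only [N, hr]
    ring
  obtain ⟨n, hn, hYn, hnN⟩ := hcard (Nat.card H) (dvd_mul_right _ _)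
  obtain ⟨j, hj, hjY⟩ := exists_equivariant_injOn hfreeH hY' hn hYn
  have key : ∀ i, ∃ f : G i →* Equiv.Perm (H × Fin n),
      (∀ h x, f (φ i h) x = (h * x.1, x.2)) ∧
      ∀ a, ∀ y ∈ Y', of (φ := φ) i a • y ∈ Y' → f a (j y) = j (of (φ := φ) i a • y) := by
    intro i
    obtain ⟨m, hm, hYm, hmN⟩ := hcard (Nat.card (G i))
      ((Finset.dvd_prod_of_mem _ (Finset.mem_univ i)).mul_left _)
    let : MulAction (G i) Z := MulAction.compHom Z (of (φ := φ) i)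
    obtain ⟨k, hk, hkY⟩ := exists_equivariant_injOn (G := G i) (hfree i) hY' hm hYm
    let actS : MulAction H (H × Fin n) :=
      { smul := fun h x => (h * x.1, x.2)
        one_smul := fun x => Prod.ext (one_mul _) rfl
        mul_smul := fun g h x => Prod.ext (mul_assoc _ _ _) rfl }
    let actT : MulAction H (G i × Fin m) :=
      { smul := fun h x => (φ i h * x.1, x.2)
        one_smul := fun x => Prod.ext (by simp [HSMul.hSMul]) rfl
        mul_smul := fun g h x => Prod.ext (by simp [HSMul.hSMul, mul_assoc]) rfl }
    obtain ⟨e, he, heY⟩ := @exists_equivariant_equiv H Z (H × Fin n) (G i × Fin m) _ _ _ _ actS actT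
      _ _ (fun u s h => mul_eq_right.1 (congrArg Prod.fst h))
      (fun u t h => (injective_iff_map_eq_one _).1 (hφ i) u (mul_eq_right.1 (congrArg Prod.fst h)))
      (by simp [hnN, hmN]) Y' hinv j hj hjY k
      (fun h z => by rw [hbase i]; exact hk (φ i h) z) hkY
    let f : G i →* Equiv.Perm (H × Fin n) :=
      { toFun := fun a => e.trans
          (((Equiv.mulLeft a).prodCongr (Equiv.refl (Fin m))).trans e.symm)
        map_one' := by
          ext x : 1
          simp
        map_mul' := fun a b => by
          ext x : 1
          simp [mul_assoc]
          rfl }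
    have hf : ∀ a x, f a x = e.symm (a * (e x).1, (e x).2) := fun _ _ => rfl
    refine ⟨f, fun h x => ?_, fun a y hy hay => ?_⟩
    · rw [hf, e.symm_apply_eq]
      exact (he h x).symm
    · rw [hf, e.symm_apply_eq, heY y hy, heY _ hay]
      exact (hk a y).symm
  choose f hf1 hf2 using key
  let i := Classical.arbitrary ι
  refine ⟨n, lift f ((f i).comp (φ i)) fun i' => ?_, j, hjY.mono hsub, fun i a y hy hay => ?_⟩
  · ext h x : 2
    simp only [MonoidHom.comp_apply, hf1]
  · rw [lift_of]
    exact hf2 i a y (hsub hy) (hsub hay)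

end FiniteAmalgams

/-! ### Separability of cyclic subgroups -/

section FiniteSeparability

/-- The element `g` is kept apart from the subgroup `C` in a finite quotient. -/
def IsSeparated {X : Type*} [Group X] (C : Subgroup X) (g : X) : Prop :=
  ∃ N : Subgroup X, N.Normal ∧ N.FiniteIndex ∧ ∀ f ∈ C, f⁻¹ * g ∉ N

theorem finitelySeparable_of_isSeparated {X : Type u} [Group X] {C : Subgroup X}
    (h : ∀ g ∉ C, IsSeparated C g) : FinitelySeparable C := by
  intro g hg
  obtain ⟨N, hN, hfin, hsep⟩ := h g hg
  refine ⟨X ⧸ N, inferInstance, inferInstance, QuotientGroup.mk' N,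
    QuotientGroup.mk'_surjective N, ?_⟩
  rintro ⟨f, hf, hfg⟩
  exact hsep f hf (QuotientGroup.eq.1 hfg)

theorem IsSeparated.of_map {X Y : Type*} [Group X] [Group Y] {C : Subgroup X} {g : X} (f : X →* Y)
    (h : IsSeparated (C.map f) (f g)) : IsSeparated C g := by
  obtain ⟨N, hN, hfin, hsep⟩ := h
  refine ⟨N.comap f, inferInstance,
    ⟨by rw [Subgroup.index_comap]; exact (N.subgroupOf f.range).index_ne_zero_of_finite⟩,
    fun c hc hcg => ?_⟩
  refine hsep (f c) (Subgroup.mem_map_of_mem f hc) ?_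
  simpa using hcg

variable {ι : Type*} {G : ι → Type*} {H : Type*} [∀ i, Group (G i)] [Group H] {φ : ∀ i, H →* G i}

/-- An action of the amalgam that agrees with the given one along the steps inside a large enough
finite set `Y` also agrees with it on the effect of `x` on `z`: the set `Y` has to contain the
points through which the letters of a word for `x` successively carry `z`. -/
theorem exists_finite_forall_agree [Nonempty ι] {Z : Type*} [MulAction (PushoutI φ) Z]
    (x : PushoutI φ) (z : Z) :
    ∃ E : Set Z, E.Finite ∧ ∀ (Y : Set Z) (T : Type _) (ψ : PushoutI φ →* Equiv.Perm T) (j : Z → T),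
      E ⊆ Y → (∀ i (a : G i), ∀ y ∈ Y, of (φ := φ) i a • y ∈ Y →
        ψ (of i a) (j y) = j (of (φ := φ) i a • y)) → ψ x (j z) = j (x • z) := by
  have hof : ∀ i (a : G i) (z : Z), ∃ E : Set Z, E.Finite ∧
      ∀ (Y : Set Z) (T : Type _) (ψ : PushoutI φ →* Equiv.Perm T) (j : Z → T),
      E ⊆ Y → (∀ i (a : G i), ∀ y ∈ Y, of (φ := φ) i a • y ∈ Y →
        ψ (of i a) (j y) = j (of (φ := φ) i a • y)) →
      ψ (of i a) (j z) = j (of (φ := φ) i a • z) := by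
    intro i a z
    exact ⟨{z, of (φ := φ) i a • z}, by simp, fun Y T ψ j hY h =>
      h i a z (hY (by simp)) (hY (by simp))⟩
  induction x using PushoutI.induction_on generalizing z with
  | of i a => exact hof i a z
  | base h =>
    rw [← of_apply_eq_base φ (Classical.arbitrary ι) h]
    exact hof _ _ z
  | mul x y hx hy =>
    obtain ⟨E, hE, hyE⟩ := hy z
    obtain ⟨F, hF, hxF⟩ := hx (y • z)
    refine ⟨E ∪ F, hE.union hF, fun Y T ψ j hY h => ?_⟩
    rw [map_mul, Equiv.Perm.mul_apply, hyE Y T ψ j (Set.subset_union_left.trans hY) h,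
      hxF Y T ψ j (Set.subset_union_right.trans hY) h, mul_smul]

/-- In an amalgam of finite groups, a cyclic subgroup without nontrivial torsion is separable. The
finite quotients come from finite approximations of the action on the cosets of the subgroup, on
which the finite factors act freely because the subgroup has no torsion. -/
theorem isSeparated_zpowers_of_torsionFree [Finite ι] [Nonempty ι] [∀ i, Finite (G i)] [Finite H]
    (hφ : ∀ i, Function.Injective (φ i)) {c g : PushoutI φ}
    (hc : ∀ x ∈ Subgroup.zpowers c, IsOfFinOrder x → x = 1) (hg : g ∉ Subgroup.zpowers c) :
    IsSeparated (Subgroup.zpowers c) g := by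
  let Z := PushoutI φ ⧸ Subgroup.zpowers c
  have hfree : ∀ i (a : G i) (z : Z), of (φ := φ) i a • z = z → a = 1 := by
    intro i a z hz
    induction z using QuotientGroup.induction_on with
    | H x =>
      have hmem : x⁻¹ * of i a⁻¹ * x ∈ Subgroup.zpowers c := by
        have := QuotientGroup.eq.1 hz
        simpa [mul_assoc] using this
      have hfin : IsOfFinOrder (x⁻¹ * of (φ := φ) i a⁻¹ * x) := by
        have := (MulAut.conj x⁻¹).toMonoidHom.isOfFinOrder
          ((of (φ := φ) i).isOfFinOrder (isOfFinOrder_of_finite a⁻¹))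
        simpa using this
      have h1 := hc _ hmem hfin
      have h2 : of (φ := φ) i a⁻¹ = 1 := by
        rwa [mul_eq_one_iff_eq_inv, mul_eq_left] at h1
      simpa using of_injective hφ i (h2.trans (map_one _).symm)
  let z : Z := ((1 : PushoutI φ) : Z)
  obtain ⟨E, hE, hgE⟩ := exists_finite_forall_agree g z
  obtain ⟨F, hF, hcF⟩ := exists_finite_forall_agree c z
  obtain ⟨n, ψ, j, hj, h⟩ := exists_finite_approximation hφ hfree
    (Y := E ∪ F ∪ {z, g • z}) ((hE.union hF).union (by simp))
  have hgz : ψ g (j z) = j (g • z) := hgE _ _ ψ j (fun _ hx => Or.inl (Or.inl hx)) h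
  have hcz : ψ c (j z) = j (c • z) := hcF _ _ ψ j (fun _ hx => Or.inl (Or.inr hx)) h
  have hc1 : c • z = z := QuotientGroup.eq.2 (by simp)
  rw [hc1] at hcz
  refine ⟨ψ.ker, inferInstance, inferInstance, ?_⟩
  rintro _ ⟨k, rfl⟩ hk
  have hk' : ψ g = ψ c ^ k := by
    rw [MonoidHom.mem_ker, map_mul, map_inv, inv_mul_eq_one] at hk
    rw [← hk, map_zpow]
  have hfix : (ψ c ^ k) (j z) = j z := Equiv.Perm.zpow_apply_eq_self_of_apply_eq_self hcz k
  rw [hk', hfix] at hgz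
  have hz : z = g • z := hj (by simp) (by simp) hgz
  refine hg ?_
  have := QuotientGroup.eq.1 hz
  simpa using this

/-- Cyclic subgroups of an amalgam of finite groups are separable. For a finite cyclic subgroup this
is residual finiteness, which is the separability of the trivial subgroup. -/
theorem isSeparated_zpowers [Finite ι] [Nonempty ι] [∀ i, Finite (G i)] [Finite H]
    (hφ : ∀ i, Function.Injective (φ i)) {c g : PushoutI φ} (hg : g ∉ Subgroup.zpowers c) :
    IsSeparated (Subgroup.zpowers c) g := by
  by_cases hc : IsOfFinOrder c
  · have hres : ∀ f : Subgroup.zpowers c, ∃ N : Subgroup (PushoutI φ),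
        N.Normal ∧ N.FiniteIndex ∧ (f : PushoutI φ)⁻¹ * g ∉ N := by
      rintro ⟨f, hf⟩
      obtain ⟨N, hN, hfin, h⟩ := isSeparated_zpowers_of_torsionFree hφ (c := 1) (g := f⁻¹ * g)
        (by simp) (by
          rw [Subgroup.zpowers_one_eq_bot, Subgroup.mem_bot, inv_mul_eq_one]
          rintro rfl
          exact hg hf)
      exact ⟨N, hN, hfin, by simpa using h 1 (one_mem _)⟩
    choose N hN hfin hsep using hres
    have : Finite (Subgroup.zpowers c) := finite_zpowers.2 hc
    refine ⟨⨅ f, N f, Subgroup.normal_iInf_normal hN, Subgroup.finiteIndex_iInf hfin, ?_⟩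
    intro f hf h
    exact hsep ⟨f, hf⟩ (Subgroup.mem_iInf.1 h _)
  · refine isSeparated_zpowers_of_torsionFree hφ ?_ hg
    rintro _ ⟨k, rfl⟩ hk
    by_contra hne
    have hk0 : k ≠ 0 := by
      rintro rfl
      simp at hne
    obtain ⟨n, hn, h⟩ := isOfFinOrder_iff_zpow_eq_one.1 hk
    refine hc (isOfFinOrder_iff_zpow_eq_one.2 ⟨k * n, mul_ne_zero hk0 hn, ?_⟩)
    rw [zpow_mul]
    exact h

end FiniteSeparability

/-! ### Passing to finite factors -/

section FiniteFactors

variable {ι : Type*} {G : ι → Type*} {H : Type*} [∀ i, Group (G i)] [Group H] {φ : ∀ i, H →* G i}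

theorem CompatibleFamily.isSeparated_of_proj [Finite ι] [Nonempty ι] (D : CompatibleFamily φ)
    {c g : PushoutI φ} (h : D.proj g ∉ Subgroup.zpowers (D.proj c)) :
    IsSeparated (Subgroup.zpowers c) g := by
  have : Finite (H ⧸ D.M) :=
    Finite.of_injective _ (D.quotMap_injective (Classical.arbitrary ι))
  refine IsSeparated.of_map D.proj ?_
  rw [MonoidHom.map_zpowers]
  exact isSeparated_zpowers D.quotMap_injective h

open CompatibleFamily

/-- If `c` is not conjugate into a factor, it keeps infinite order in some `D.QuotAmalgam`. There at
most one power of `c` has the same image as `g`, and a second family tells that power from `g`. -/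
theorem CompatibleFamily.Separating.exists_proj_notMem_zpowers [Nonempty ι] (hs : Separating φ)
    {c g : PushoutI φ} (hc : ∀ y i a, c ≠ y * of i a * y⁻¹) (hg : g ∉ Subgroup.zpowers c) :
    ∃ D : CompatibleFamily φ, D.proj g ∉ Subgroup.zpowers (D.proj c) := by
  obtain ⟨D, hD⟩ := hs.exists_orderOf_proj_eq_zero hc
  by_cases hgD : D.proj g ∈ Subgroup.zpowers (D.proj c)
  · obtain ⟨k, hk⟩ := hgD
    obtain ⟨E, hE⟩ := hs.exists_proj_ne_one (x := (c ^ k)⁻¹ * g) (by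
      rw [Ne, inv_mul_eq_one]
      rintro rfl
      exact hg ⟨k, rfl⟩)
    refine ⟨D ⊓ E, ?_⟩
    rintro ⟨m, hm⟩
    have hker : (c ^ m)⁻¹ * g ∈ (D ⊓ E).proj.ker := by
      rw [MonoidHom.mem_ker, map_mul, map_inv, map_zpow, inv_mul_eq_one]
      exact hm
    have hDk := ker_proj_mono (inf_le_left D E) hker
    rw [MonoidHom.mem_ker, map_mul, map_inv, map_zpow, inv_mul_eq_one, ← hk] at hDk
    obtain rfl : m = k :=
      injective_zpow_iff_not_isOfFinOrder.2 (orderOf_eq_zero_iff.1 hD) hDk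
    exact hE (ker_proj_mono (inf_le_right D E) hker)
  · exact ⟨D, hgD⟩

/-- If the compatible families separate `⟨a⟩` in its factor, they separate it in the amalgam. -/
theorem CompatibleFamily.Separating.exists_proj_of_notMem_zpowers [Nonempty ι] (hs : Separating φ)
    {i : ι} {a : G i}
    (ha : ∀ b ∉ Subgroup.zpowers a, ∃ D : CompatibleFamily φ, ∀ k : ℤ, (a ^ k)⁻¹ * b ∉ D.N i)
    {g : PushoutI φ} (hg : g ∉ Subgroup.zpowers (of (φ := φ) i a)) :
    ∃ D : CompatibleFamily φ, D.proj g ∉ Subgroup.zpowers (D.proj (of i a)) := by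
  by_cases hgi : g ∈ (of (φ := φ) i).range
  · obtain ⟨b, rfl⟩ := hgi
    obtain ⟨D, hD⟩ := ha b (by
      rintro ⟨k, rfl⟩
      exact hg ⟨k, by simp⟩)
    refine ⟨D, ?_⟩
    rintro ⟨k, hk⟩
    simp only [proj_of, ← map_zpow] at hk
    have := of_injective D.quotMap_injective i hk
    exact hD k (QuotientGroup.eq.1 this)
  · obtain ⟨D, hD⟩ := hs.exists_proj_notMem_range hgi
    refine ⟨D, ?_⟩
    rintro ⟨k, hk⟩
    rw [← hk] at hD
    exact hD ⟨((a ^ k : G i) : G i ⧸ D.N i), by simp⟩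

/-- A cyclic subgroup of the amalgam of a finite family of groups is separable if the compatible
families separate every cyclic subgroup of a factor to which it is conjugate. -/
theorem CompatibleFamily.Separating.isSeparated_zpowers [Finite ι] [Nonempty ι] (hs : Separating φ)
    {c : PushoutI φ}
    (hc : ∀ y i (a : G i), c = y * of i a * y⁻¹ → ∀ b ∉ Subgroup.zpowers a,
      ∃ D : CompatibleFamily φ, ∀ k : ℤ, (a ^ k)⁻¹ * b ∉ D.N i)
    {g : PushoutI φ} (hg : g ∉ Subgroup.zpowers c) : IsSeparated (Subgroup.zpowers c) g := by
  by_cases h : ∃ y i a, c = y * of (φ := φ) i a * y⁻¹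
  · obtain ⟨y, i, a, rfl⟩ := h
    have hconj : (Subgroup.zpowers (y * of i a * y⁻¹)).map (MulAut.conj y⁻¹).toMonoidHom =
        Subgroup.zpowers (of (φ := φ) i a) := by
      rw [MonoidHom.map_zpowers]
      simp [mul_assoc]
    refine IsSeparated.of_map (MulAut.conj y⁻¹).toMonoidHom ?_
    have hg' : (MulAut.conj y⁻¹).toMonoidHom g ∉ Subgroup.zpowers (of (φ := φ) i a) := by
      rwa [← hconj, Subgroup.mem_map_iff_mem (MulAut.conj y⁻¹).injective]
    rw [hconj]
    obtain ⟨D, hD⟩ := hs.exists_proj_of_notMem_zpowers (hc y i a rfl) hg'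
    exact D.isSeparated_of_proj hD
  · push Not at h
    obtain ⟨D, hD⟩ := hs.exists_proj_notMem_zpowers h hg
    exact D.isSeparated_of_proj hD

end FiniteFactors

/-! ### The compatible pairs of normal subgroups -/

section TwoFactors

theorem SeparableBy.exists_mem {X : Type*} [Group X] {Ψ : Set (Subgroup X)} {F : Subgroup X}
    (h : SeparableBy Ψ F) {g : X} (hg : g ∉ F) : ∃ N ∈ Ψ, ∀ f ∈ F, f⁻¹ * g ∉ N := by
  rw [← SetLike.mem_coe, ← h, Set.mem_iInter₂] at hg
  push Not at hg
  obtain ⟨N, hN, hgN⟩ := hg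
  exact ⟨N, hN, fun f hf hfg => hgN ⟨f, hf, f⁻¹ * g, hfg, by simp⟩⟩

theorem exists_notMem_of_sInf_eq_bot {X : Type*} [Group X] {Ψ : Set (Subgroup X)}
    (h : sInf Ψ = ⊥) {g : X} (hg : g ≠ 1) : ∃ N ∈ Ψ, g ∉ N := by
  rw [Ne, ← Subgroup.mem_bot, ← h, Subgroup.mem_sInf] at hg
  push Not at hg
  exact hg

variable {A B : Type u} [Group A] [Group B] {H : Subgroup A} {K : Subgroup B} {φ : H ≃* K}

/-- The members of `Ω` are compatible families for the two embeddings `factorMap H K φ`. -/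
theorem exists_compatibleFamily {P : Subgroup A × Subgroup B} (hP : P ∈ Omega H K φ) :
    ∃ D : CompatibleFamily (factorMap H K φ), D.N true = P.1 ∧ D.N false = P.2 := by
  obtain ⟨R, S⟩ := P
  obtain ⟨hR, hRf, hS, hSf, hc⟩ := hP
  refine ⟨{
    N := fun
      | true => R
      | false => S
    M := R.subgroupOf H
    normal := fun
      | true => hR
      | false => hS
    finiteIndex := fun
      | true => hRf
      | false => hSf
    normal_base := hR.subgroupOf H
    comap_eq := fun
      | true => rfl
      | false => ?_ }, rfl, rfl⟩
  change (S.subgroupOf K).comap φ.toMonoidHom = _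
  rw [← hc]
  exact Subgroup.comap_map_eq_self_of_injective φ.injective _

theorem exists_compatibleFamily_of_mem_OmegaA {R : Subgroup A} (hR : R ∈ OmegaA H K φ) :
    ∃ D : CompatibleFamily (factorMap H K φ), D.N true = R := by
  obtain ⟨P, hP, rfl⟩ := hR
  exact (exists_compatibleFamily hP).imp fun _ h => h.1

theorem exists_compatibleFamily_of_mem_OmegaB {S : Subgroup B} (hS : S ∈ OmegaB H K φ) :
    ∃ D : CompatibleFamily (factorMap H K φ), D.N false = S := by
  obtain ⟨P, hP, rfl⟩ := hS
  exact (exists_compatibleFamily hP).imp fun _ h => h.2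

theorem separating_of_isFiltration (hA : IsFiltration (OmegaA H K φ) H)
    (hB : IsFiltration (OmegaB H K φ) K) :
    CompatibleFamily.Separating (factorMap H K φ) := by
  constructor
  · rintro (_ | _) a ha
    · obtain ⟨S, hS, h⟩ := exists_notMem_of_sInf_eq_bot hB.2.1 ha
      obtain ⟨D, rfl⟩ := exists_compatibleFamily_of_mem_OmegaB hS
      exact ⟨D, h⟩
    · obtain ⟨R, hR, h⟩ := exists_notMem_of_sInf_eq_bot hA.2.1 ha
      obtain ⟨D, rfl⟩ := exists_compatibleFamily_of_mem_OmegaA hR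
      exact ⟨D, h⟩
  · rintro (_ | _) a ha
    · have haK : (show B from a) ∉ K := fun h => ha ⟨φ.symm ⟨a, h⟩, by
        change ((φ (φ.symm ⟨a, h⟩) : K) : B) = a
        rw [φ.apply_symm_apply]⟩
      obtain ⟨S, hS, h⟩ := hB.2.2.exists_mem haK
      obtain ⟨D, rfl⟩ := exists_compatibleFamily_of_mem_OmegaB hS
      exact ⟨D, fun x => h _ (φ x).2⟩
    · have haH : (show A from a) ∉ H := fun h => ha ⟨⟨a, h⟩, rfl⟩
      obtain ⟨R, hR, h⟩ := hA.2.2.exists_mem haH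
      obtain ⟨D, rfl⟩ := exists_compatibleFamily_of_mem_OmegaA hR
      exact ⟨D, fun x => h _ x.2⟩

theorem areConj_zpowers {X Y : Type*} [Group X] [Group Y] (f : Y →* X) (x : X) (a : Y) :
    AreConj (Subgroup.zpowers (x * f a * x⁻¹)) ((Subgroup.zpowers a).map f) :=
  ⟨x, by simp [MonoidHom.map_zpowers]⟩

end TwoFactors

end AmalgSep

theorem theorem1p2 {A B : Type u} [Group A] [Group B] (H : Subgroup A) (K : Subgroup B)
    (φ : H ≃* K)
    (hA : AmalgSep.IsFiltration (AmalgSep.OmegaA H K φ) H)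
    (hB : AmalgSep.IsFiltration (AmalgSep.OmegaB H K φ) K)
    (C : Subgroup (AmalgSep.Amalgam H K φ)) (hC : IsCyclic C)
    (hCA : ∀ F ∈ AmalgSep.LambdaA H K φ, ¬ AmalgSep.AreConj C (F.map (AmalgSep.inA H K φ)))
    (hCB : ∀ F ∈ AmalgSep.LambdaB H K φ, ¬ AmalgSep.AreConj C (F.map (AmalgSep.inB H K φ))) :
    AmalgSep.FinitelySeparable C := by
  obtain ⟨c, rfl⟩ := Subgroup.isCyclic_iff_exists_zpowers_eq_top C |>.1 hC
  refine AmalgSep.finitelySeparable_of_isSeparated fun g hg =>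
    (AmalgSep.separating_of_isFiltration hA hB).isSeparated_zpowers ?_ hg
  rintro y (_ | _) a rfl b hb
  · have hsep : AmalgSep.SeparableBy (AmalgSep.OmegaB H K φ) (Subgroup.zpowers (show B from a)) := by
      by_contra hns
      exact hCB _ ⟨inferInstance, hns⟩ (AmalgSep.areConj_zpowers (AmalgSep.inB H K φ) y a)
    obtain ⟨S, hS, h⟩ := hsep.exists_mem hb
    obtain ⟨D, rfl⟩ := AmalgSep.exists_compatibleFamily_of_mem_OmegaB hS
    exact ⟨D, fun k => h _ ⟨k, rfl⟩⟩
  · have hsep : AmalgSep.SeparableBy (AmalgSep.OmegaA H K φ) (Subgroup.zpowers (show A from a)) := by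
      by_contra hns
      exact hCA _ ⟨inferInstance, hns⟩ (AmalgSep.areConj_zpowers (AmalgSep.inA H K φ) y a)
    obtain ⟨R, hR, h⟩ := hsep.exists_mem hb
    obtain ⟨D, rfl⟩ := AmalgSep.exists_compatibleFamily_of_mem_OmegaA hR
    exact ⟨D, fun k => h _ ⟨k, rfl⟩⟩
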